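/- Consider the recode-and-forward relay network with one source S, relays $R_1,\dots,R_L$ and one destination D over a finite field $\mathbb F_q$. Let $K,N_S,N_R\ge 0$ be integers and let $\epsilon_{SD},\epsilon_{SR_j},\epsilon_{R_jD}\in[0,1]$ be the packet erasure probabilities of the links. In stage one S broadcasts $N_S$ packets whose coefficient vectors in $\mathbb F_q^K$ are independent and uniform; each packet is erased independently at D with probability $\epsilon_{SD}$ and at $R_j$ with probability $\epsilon_{SR_j}$. In stage two each relay $R_j$, having received $m_j$ packets with coefficient matrix $C_{S\to R_j}\in\mathbb F_q^{m_j\times K}$, draws a uniform recoding matrix $G_j\in\mathbb F_q^{N_R\times m_j}$ and sends the $N_R$ packets with coefficient rows $G_jC_{S\to R_j}$ to D, each of which is erased independently with probability $\epsilon_{R_jD}$. All coefficients and erasures are independent. The decoding probability $P_R^{(L)}$ is the probability that the matrix of all coefficient rows received by D (directly from S, and from all relays) has rank $K$. With $0^0=1$ and with empty products equal to $1$ and empty sums equal to $0$, put $$\mathcal B(m,N,\epsilon)=\binom Nm(1-\epsilon)^m\epsilon^{N-m},\qquad \mathbb P(m,K)=\prod_{i=0}^{K-1}(1-q^{i-m}),$$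 $$\mathbb P_r(m,K)=\frac1{q^{m(K-r)}}\prod_{i=0}^{r-1}\frac{q^K-q^i}{q^r-q^i}\prod_{i=0}^{r-1}(1-q^{i-m})\quad(0\le r\le \min(m,K)),$$ $$\mathbb P^{(2)}\big((m_1,m_2,m_{12}),K\big)=\sum_{i=\max(0,\,K-m_1+m_{12},\,K-m_2+m_{12})}^{\min(m_{12},K)}\mathbb P_i(m_{12},K)\,\mathbb P(m_1-m_{12},K-i)\,\mathbb P(m_2-m_{12},K-i),$$ and, for $\mathbf m=(m,m_D,m_{RD})$ and $\boldsymbol\epsilon=(\tilde\epsilon_{SR},\epsilon_{SD})$ with $\tilde\epsilon_{SR}=\prod_{j=1}^L\epsilon_{SR_j}$, $$\alpha(\mathbf m,N_S,\boldsymbol\epsilon)=\binom{N_S}{m_{RD}}\binom{N_S-m_{RD}}{m-m_{RD}}\binom{N_S-m}{m_D-m_{RD}}(1-\tilde\epsilon_{SR})^m\tilde\epsilon_{SR}^{\,N_S-m}(1-\epsilon_{SD})^{m_D}\epsilon_{SD}^{\,N_S-m_D}.$$ Let $$U^{(L)}=\sum_{\mathbf m}\alpha(\mathbf m,N_S,\boldsymbol\epsilon)\sum_{m'_1,\dots,m'_L}\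 \prod_{j=1}^L\mathcal B(m'_j,N_R,\epsilon_{R_jD})\ \mathbb P^{(2)}\big((m'+m_D,\;m-m_{RD}+m_D,\;m_D),K\big),\qquad m'=\sum_{j=1}^L m'_j,$$ where the sums run over the nonnegative integers with $m,m_D\le N_S$, $m+m_D\ge K$, $\max(0,m+m_D-N_S)\le m_{RD}\le\min(m,m_D)$, $m'_j\le N_R$ and $m'\ge K-m_D$. Then for $L=1$ one has $P_R^{(1)}=U^{(1)}$; that is, writing $\epsilon_{SR}=\epsilon_{SR_1}$ and $\epsilon_{RD}=\epsilon_{R_1D}$ (so $\tilde\epsilon_{SR}=\epsilon_{SR}$), with the same summation ranges, $$P_R^{(1)}=\sum_{\mathbf m}\alpha\big(\mathbf m,N_S,(\epsilon_{SR},\epsilon_{SD})\big)\sum_{m'}\mathcal B(m',N_R,\epsilon_{RD})\,\mathbb P^{(2)}\big((m'+m_D,\;m-m_{RD}+m_D,\;m_D),K\big).$$ -/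

import Mathlib

open scoped unitInterval

noncomputable section

namespace RelayRLNC

/-! ### The random experiment -/

/-- The joint law of a finite family of independent finite-valued random variables with laws
`p i`. -/
def indep {ι : Type*} [Fintype ι] [DecidableEq ι] {α : ι → Type*} [∀ i, Fintype (α i)]
    (p : ∀ i, PMF (α i)) : PMF (∀ i, α i) :=
  PMF.ofFintype (fun f => ∏ i, p i (f i)) (by
    rw [← Fintype.prod_sum]
    refine Finset.prod_eq_one fun i _ => ?_
    rw [← tsum_fintype (L := .unconditional _)]
    exact (p i).tsum_coe)

/-- One packet sent over a link with packet erasure probability `ε`: `true` means that the packet is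
delivered (probability `1 - ε`), `false` that it is erased (probability `ε`). -/
def packet (ε : I) : PMF Bool :=
  PMF.ofFintype (fun b => ENNReal.ofReal (if b then 1 - (ε : ℝ) else ε)) (by
    rw [Fintype.sum_bool]
    simp only [if_true, Bool.false_eq_true, if_false]
    rw [← ENNReal.ofReal_add (by linarith [ε.2.2]) ε.2.1]
    simp)

/-- `N` packets sent over a link with packet erasure probability `ε`, independently erased. -/
def link (N : ℕ) (ε : I) : PMF (Fin N → Bool) :=
  indep fun _ => packet ε

/-- The index set of the packets that are delivered when the delivery pattern is `d`. -/
abbrev Delivered {N : ℕ} (d : Fin N → Bool) : Type := {i : Fin N // d i = true}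

/-- The rows of `A` that are delivered. -/
def deliveredRows {N : ℕ} {κ F : Type*} (d : Fin N → Bool) (A : Matrix (Fin N) κ F) :
    Matrix (Delivered d) κ F :=
  A.submatrix Subtype.val id

/-- The matrix of all coding coefficients collected by the destination: the source packets it
received directly, stacked over the received recoded packets of all relays. Here
* `C` holds the coefficients of the `NS` coded packets broadcast by the source,
* `dSD`, `dSR j` are the delivery patterns from the source to the destination and to relay `j`,
* `G j` is the recoding matrix of relay `j`, with one column per packet that the relay received,
* `dRD j` is the delivery pattern from relay `j` to the destination. -/
def destMatrix {F : Type*} [Field F] {L K NS NR : ℕ}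
    (C : Matrix (Fin NS) (Fin K) F) (dSD : Fin NS → Bool) (dSR : Fin L → Fin NS → Bool)
    (G : ∀ j, Matrix (Fin NR) (Delivered (dSR j)) F) (dRD : Fin L → Fin NR → Bool) :
    Matrix (Delivered dSD ⊕ (Σ j, Delivered (dRD j))) (Fin K) F :=
  Matrix.fromRows (deliveredRows dSD C)
    (Matrix.blockDiagonal' (fun j => deliveredRows (dRD j) (G j)) *
      Matrix.of (fun x : (Σ j, Delivered (dSR j)) => deliveredRows (dSR x.1) C x.2))

/-- The law of the rank of the destination's coefficient matrix in the recode-and-forward scheme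
with `L` relays. All coding and recoding coefficients are uniform on `F`, and all coefficients and
packet erasures are independent. -/
def destRank (F : Type*) [Field F] [Fintype F] (L K NS NR : ℕ)
    (εSD : I) (εSR εRD : Fin L → I) : PMF ℕ :=
  (PMF.uniformOfFintype (Matrix (Fin NS) (Fin K) F)).bind fun C =>
  (link NS εSD).bind fun dSD =>
  (indep fun j => link NS (εSR j)).bind fun dSR =>
  (indep fun j => PMF.uniformOfFintype (Matrix (Fin NR) (Delivered (dSR j)) F)).bind fun G =>
  (indep fun j => link NR (εRD j)).bind fun dRD =>
  PMF.pure (destMatrix C dSD dSR G dRD).rank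

/-- The decoding probability of the `L`-relay network: the probability that the destination's
coefficient matrix has rank `K`. -/
def decodingProb (F : Type*) [Field F] [Fintype F] (L K NS NR : ℕ)
    (εSD : I) (εSR εRD : Fin L → I) : ℝ :=
  (destRank F L K NS NR εSD εSR εRD K).toReal

/-! ### The closed-form quantities -/

/-- The binomial probability of `m` deliveries in `N` transmissions, each erased with
probability `ε`. -/
def binomPMF (m N : ℕ) (ε : ℝ) : ℝ :=
  (N.choose m : ℝ) * (1 - ε) ^ m * ε ^ (N - m)

/-- The full-rank probability `∏_{i=0}^{K-1} (1 - q^(i-m))`, with integer exponents. -/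
def probFull (q m K : ℕ) : ℝ :=
  ∏ i ∈ Finset.range K, (1 - (q : ℝ) ^ ((i : ℤ) - (m : ℤ)))

/-- The Gaussian binomial coefficient, for `r ≤ K`. -/
def gaussBinom (q K r : ℕ) : ℝ :=
  ∏ i ∈ Finset.range r, (((q : ℝ) ^ K - (q : ℝ) ^ i) / ((q : ℝ) ^ r - (q : ℝ) ^ i))

/-- The rank-`r` probability of an `m × K` matrix, for `r ≤ min m K`. -/
def probRank (q r m K : ℕ) : ℝ :=
  1 / (q : ℝ) ^ (m * (K - r)) * gaussBinom q K r *
    ∏ i ∈ Finset.range r, (1 - (q : ℝ) ^ ((i : ℤ) - (m : ℤ)))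

/-- The joint full-rank probability of an `m₁ × K` and an `m₂ × K` matrix with `m₁₂ ≤ m₁, m₂` common
rows. The summation runs from `max (0, K - m₁ + m₁₂, K - m₂ + m₁₂)` to `min (m₁₂, K)`; the
truncated subtraction of `ℕ` supplies the `0`. -/
def probTwo (q m₁ m₂ m₁₂ K : ℕ) : ℝ :=
  ∑ i ∈ Finset.Icc (max (K + m₁₂ - m₁) (K + m₁₂ - m₂)) (min m₁₂ K),
    probRank q i m₁₂ K * (probFull q (m₁ - m₁₂) (K - i) * probFull q (m₂ - m₁₂) (K - i))

/-- The joint probability of the numbers of source packets received by the (equivalent) relay (`m`),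
by the destination (`mD`), and by both (`mRD`). -/
def alpha (m mD mRD NS : ℕ) (εSR εSD : ℝ) : ℝ :=
  (NS.choose mRD : ℝ) * ((NS - mRD).choose (m - mRD) : ℝ) * ((NS - m).choose (mD - mRD) : ℝ) *
    ((1 - εSR) ^ m * εSR ^ (NS - m)) * ((1 - εSD) ^ mD * εSD ^ (NS - mD))

/-- The sum over all `(m, mD, mRD)` with `m, mD ≤ NS`, `m + mD ≥ K` and
`max (0, m + mD - NS) ≤ mRD ≤ min (m, mD)`. -/
def sumStageOne (K NS : ℕ) (f : ℕ → ℕ → ℕ → ℝ) : ℝ :=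
  ∑ m ∈ Finset.range (NS + 1), ∑ mD ∈ Finset.range (NS + 1) with K ≤ m + mD,
    ∑ mRD ∈ Finset.Icc (m + mD - NS) (min m mD), f m mD mRD

/-- The upper bound on the decoding probability of an `L`-relay network. -/
def relayBound (q L K NS NR : ℕ) (εSD : ℝ) (εSR εRD : Fin L → ℝ) : ℝ :=
  sumStageOne K NS fun m mD mRD =>
    alpha m mD mRD NS (∏ j, εSR j) εSD *
      ∑ m' ∈ Fintype.piFinset (fun _ : Fin L => Finset.range (NR + 1)) with K ≤ mD + ∑ j, m' j,
        (∏ j, binomPMF (m' j) NR (εRD j)) *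
          probTwo q ((∑ j, m' j) + mD) (m - mRD + mD) mD K

/-- The single-relay expression. -/
def singleRelaySum (q K NS NR : ℕ) (εSD εSR εRD : ℝ) : ℝ :=
  sumStageOne K NS fun m mD mRD =>
    alpha m mD mRD NS εSR εSD *
      ∑ m' ∈ Finset.range (NR + 1) with K ≤ mD + m',
        binomPMF m' NR εRD * probTwo q (m' + mD) (m - mRD + mD) mD K

end RelayRLNC

end

namespace RelayRLNC

open scoped BigOperators
open Finset

/-! The destination decodes iff only x = 0 is killed by every row it holds. Let `A` be the rows
received directly. On `ker A` the packets shared with the relay already vanish, so of the relay's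
packets only the innovative ones matter (`rank_destMatrix_iff`). Let `C'` be their rows and `G'` the
corresponding columns of the delivered recoding rows. Decoding means that `G' * C'` is injective on
`ker A`.

For fixed erasures, `A`, `C'` and `G'` are independent and uniform, being disjoint blocks of uniform
matrices. If `A` has rank i, then `ker A` has dimension K - i. `C'` must be injective on it; its
image then has the same dimension, and `G'` must be injective there. Hence the product of two
full-rank probabilities (`expect_mul_injOn`), and averaging over the rank of `A` gives exactly
`probTwo` (`expect_decodable`). Sorting erasure patterns by their counts (`sum_link`,
`sum_link_link`) produces the binomial and `alpha` weights. -/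

/-- Uniform averages are preserved under pulling back along a surjective homomorphism. -/
theorem expect_comp_of_surjective {X Y : Type*} [AddGroup X] [AddGroup Y] [Fintype X] [Fintype Y]
    (φ : X →+ Y) (hφ : Function.Surjective φ) (f : Y → ℝ) :
    𝔼 x, f (φ x) = 𝔼 y, f y := by
  classical
  have key : ∀ g : Y → ℝ, ∑ x, g (φ x) = #{x | φ x = 0} * ∑ y, g y := fun g => by
    rw [← Finset.sum_fiberwise_of_maps_to (s := univ) (t := univ) (g := φ) (fun _ _ => mem_univ _),
      Finset.mul_sum]
    refine Finset.sum_congr rfl fun y _ => ?_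
    rw [Finset.sum_congr rfl (g := fun _ => g y) fun x hx => by rw [(mem_filter.1 hx).2],
      Finset.sum_const, nsmul_eq_mul, AddMonoidHom.card_fiber_eq_of_mem_range φ (hφ y) (hφ 0)]
  -- The constant function 1 gives |X| = |ker φ| * |Y|, so the kernel size cancels from the average.
  have h1 := key 1
  have hX : (Fintype.card X : ℝ) ≠ 0 := by simp
  simp only [Pi.one_apply, sum_const, card_univ, nsmul_eq_mul, mul_one] at h1
  rw [Fintype.expect_eq_sum_div_card, Fintype.expect_eq_sum_div_card, key, h1]
  rw [h1] at hX
  exact mul_div_mul_left _ _ (left_ne_zero_of_mul hX)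

/-! ### Ranks and injectivity of uniform matrices over a finite field. -/

section Counting

variable {F : Type*} [Field F] [Fintype F]

theorem prod_sub_eq_probFull {q : ℕ} (hq : q ≠ 0) (n r : ℕ) :
    ∏ j ∈ range r, ((q : ℝ) ^ n - (q : ℝ) ^ j) = (q : ℝ) ^ (n * r) * probFull q n r := by
  have hq' : (q : ℝ) ≠ 0 := by exact_mod_cast hq
  have hc : (q : ℝ) ^ (n * r) = ∏ _j ∈ range r, (q : ℝ) ^ n := by simp [pow_mul]
  rw [probFull, hc, ← prod_mul_distrib]
  refine prod_congr rfl fun j _ => ?_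
  rw [mul_sub, mul_one, zpow_sub₀ hq', zpow_natCast, zpow_natCast]
  field_simp

/-- The factor i = n is 1 - q^0. This vanishing is what makes the restricted summation ranges
harmless. -/
theorem probFull_eq_zero {q n r : ℕ} (h : n < r) : probFull q n r = 0 :=
  prod_eq_zero (mem_range.2 h) (by simp)

/-- The number of linearly independent `r`-tuples, without restriction on `r`. -/
theorem card_linearIndependent_real {V : Type*} [AddCommGroup V] [Module F V] [Finite V] (r : ℕ) :
    (Nat.card {s : Fin r → V // LinearIndependent F s} : ℝ) =
      ∏ j ∈ range r, ((Fintype.card F : ℝ) ^ Module.finrank F V - (Fintype.card F : ℝ) ^ j) := by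
  have := Fintype.ofFinite V
  rcases le_or_gt r (Module.finrank F V) with h | h
  · rw [card_linearIndependent h, Finset.prod_range, Nat.cast_prod]
    refine prod_congr rfl fun j _ => ?_
    rw [Nat.cast_sub (Nat.pow_le_pow_right Fintype.card_pos (j.2.le.trans h))]
    push_cast
    rfl
  · rw [prod_eq_zero (mem_range.2 h) (sub_self _)]
    have : IsEmpty {s : Fin r → V // LinearIndependent F s} :=
      ⟨fun s => h.not_ge (by simpa using s.2.fintype_card_le_finrank)⟩
    simp

theorem expect_linearIndependent (ν : Type*) [Fintype ν] [DecidableEq ν] (r : ℕ) :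
    (𝔼 s : Fin r → ν → F, open Classical in if LinearIndependent F s then (1 : ℝ) else 0) =
      probFull (Fintype.card F) (Fintype.card ν) r := by
  classical
  have h := card_linearIndependent_real (F := F) (V := ν → F) r
  rw [Nat.card_eq_fintype_card, Fintype.card_subtype, Module.finrank_fintype_fun_eq_card,
    prod_sub_eq_probFull Fintype.card_ne_zero] at h
  rw [Fintype.expect_eq_sum_div_card, Finset.sum_boole, h]
  have : (Fintype.card F : ℝ) ≠ 0 := by simp
  simp [← pow_mul]

/-- The probability that a uniform matrix is injective on a subspace. -/
theorem expect_injOn {ν κ : Type*} [Fintype ν] [DecidableEq ν] [Fintype κ] [DecidableEq κ]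
    (V : Submodule F (κ → F)) :
    (𝔼 M : Matrix ν κ F, open Classical in
      if ∀ x ∈ V, M.mulVec x = 0 → x = 0 then (1 : ℝ) else 0) =
      probFull (Fintype.card F) (Fintype.card ν) (Module.finrank F V) := by
  classical
  let v := Module.finBasis F V
  let φ : Matrix ν κ F →+ (Fin (Module.finrank F V) → ν → F) :=
    { toFun := fun M i => M.mulVec (v i : κ → F)
      map_zero' := by ext; simp
      map_add' := fun A B => by ext; simp [Matrix.add_mulVec] }
  -- A linear map on `V` may send the basis `v` anywhere, and it extends to the whole space. So the
  -- images of a basis under a uniform matrix form a uniform tuple.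
  have hφ : Function.Surjective φ := by
    intro s
    obtain ⟨g, hg⟩ := (v.constr F s).exists_extend
    refine ⟨LinearMap.toMatrix' g, ?_⟩
    funext i
    change (LinearMap.toMatrix' g).mulVec _ = _
    rw [LinearMap.toMatrix'_mulVec]
    have := LinearMap.congr_fun hg (v i)
    simpa using this
  rw [← expect_linearIndependent ν, ← expect_comp_of_surjective φ hφ]
  refine Finset.expect_congr rfl fun M _ => ?_
  refine if_congr ?_ rfl rfl
  have hc : φ M = (M.mulVecLin ∘ₗ V.subtype) ∘ v := rfl
  rw [hc]
  constructor
  · intro h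
    refine v.linearIndependent.map' _ ?_
    rw [LinearMap.ker_eq_bot']
    intro x hx
    exact Subtype.ext (h x x.2 hx)
  · intro h x hx hMx
    have hsum := v.sum_repr ⟨x, hx⟩
    have h0 := Fintype.linearIndependent_iff.1 h (v.repr ⟨x, hx⟩) (by
      have := congrArg (M.mulVecLin ∘ₗ V.subtype) hsum
      rw [map_sum] at this
      simpa [hMx] using this)
    simp only [h0, zero_smul, sum_const_zero] at hsum
    exact (congrArg Subtype.val hsum).symm

/-- The number of matrices of rank `r`, multiplied by the number of bases of an `r`-dimensional
space. -/
theorem card_rank_mul {α κ : Type*} [Fintype α] [DecidableEq α] [Fintype κ] [DecidableEq κ]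
    (r : ℕ) :
    (#{M : Matrix α κ F | M.rank = r} : ℝ) *
        ∏ j ∈ range r, ((Fintype.card F : ℝ) ^ r - (Fintype.card F : ℝ) ^ j) =
      (∏ j ∈ range r, ((Fintype.card F : ℝ) ^ Fintype.card α - (Fintype.card F : ℝ) ^ j)) *
      ∏ j ∈ range r, ((Fintype.card F : ℝ) ^ Fintype.card κ - (Fintype.card F : ℝ) ^ j) := by
  classical
  -- Double counting of the factorizations `M = Xᵀ * Y` with the rows of `X` and of `Y` independent:
  -- the rows of `X` form a basis of the column space of `M`, and `X` determines `Y`.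
  let SX : Finset (Matrix (Fin r) α F) := {X | LinearIndependent F X.row}
  let SY : Finset (Matrix (Fin r) κ F) := {Y | LinearIndependent F Y.row}
  have hX : (#SX : ℝ) = ∏ j ∈ range r,
      ((Fintype.card F : ℝ) ^ Fintype.card α - (Fintype.card F : ℝ) ^ j) := by
    have h := card_linearIndependent_real (F := F) (V := α → F) r
    rwa [Nat.card_eq_fintype_card, Fintype.card_subtype,
      Module.finrank_fintype_fun_eq_card] at h
  have hY : (#SY : ℝ) = ∏ j ∈ range r,
      ((Fintype.card F : ℝ) ^ Fintype.card κ - (Fintype.card F : ℝ) ^ j) := by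
    have h := card_linearIndependent_real (F := F) (V := κ → F) r
    rwa [Nat.card_eq_fintype_card, Fintype.card_subtype,
      Module.finrank_fintype_fun_eq_card] at h
  have hinj : ∀ X ∈ SX, Function.Injective X.transpose.mulVec := fun X hXm =>
    Matrix.mulVec_injective_iff.2 (mem_filter.1 hXm).2
  have hrk : ∀ X ∈ SX, ∀ Y : Matrix (Fin r) κ F, (X.transpose * Y).rank = Y.rank := by
    intro X hXm Y
    rw [Matrix.rank, Matrix.rank, Matrix.mulVecLin_mul, LinearMap.range_comp]
    exact ((Submodule.equivMapOfInjective _ (hinj X hXm) _).finrank_eq).symm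
  have hYrk : ∀ Y : Matrix (Fin r) κ F, Y ∈ SY ↔ Y.rank = r := by
    intro Y
    simp only [SY, mem_filter, mem_univ, true_and]
    rw [Matrix.rank_eq_finrank_span_row, linearIndependent_iff_card_eq_finrank_span]
    simp [Set.finrank, eq_comm]
  have hfib : ∀ M ∈ (univ.filter fun M : Matrix α κ F => M.rank = r),
      (#{p ∈ SX ×ˢ SY | p.1.transpose * p.2 = M} : ℝ) =
        ∏ j ∈ range r, ((Fintype.card F : ℝ) ^ r - (Fintype.card F : ℝ) ^ j) := by
    intro M hM
    have hM : M.rank = r := (mem_filter.1 hM).2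
    let W := LinearMap.range M.mulVecLin
    have h := card_linearIndependent_real (F := F) (V := W) r
    have hW : Module.finrank F W = r := hM
    rw [hW] at h
    rw [← h, Nat.card_eq_fintype_card, Fintype.card_subtype]
    norm_cast
    have hrange : ∀ X ∈ SX, ∀ Y ∈ SY, X.transpose * Y = M →
        LinearMap.range X.transpose.mulVecLin = W := by
      intro X hXm Y hYm h
      symm
      refine Submodule.eq_of_le_of_finrank_le ?_ ?_
      · simp only [W, ← h, Matrix.mulVecLin_mul]
        exact LinearMap.range_comp_le_range _ _
      · rw [hW]
        exact X.transpose.rank_le_card_width.trans_eq (Fintype.card_fin r)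
    have hmem : ∀ p ∈ {p ∈ SX ×ˢ SY | p.1.transpose * p.2 = M}, ∀ k, p.1 k ∈ W := by
      intro p hp k
      obtain ⟨hp1, hp2⟩ := mem_filter.1 hp
      obtain ⟨h1, h2⟩ := mem_product.1 hp1
      rw [← hrange _ h1 _ h2 hp2]
      refine ⟨Pi.single k 1, ?_⟩
      rw [Matrix.mulVecLin_apply, Matrix.mulVec_single_one]
      rfl
    refine Finset.card_bij (fun p hp k => ⟨p.1 k, hmem p hp k⟩) ?_ ?_ ?_
    · intro p hp
      obtain ⟨h1, -⟩ := mem_product.1 (mem_filter.1 hp).1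
      simp only [mem_filter, mem_univ, true_and]
      exact LinearIndependent.of_comp W.subtype (mem_filter.1 h1).2
    · rintro ⟨X, Y⟩ hp ⟨X', Y'⟩ hp' heq
      have hXX : X = X' := by
        ext k a
        exact congrFun (congrArg Subtype.val (congrFun heq k)) a
      subst hXX
      obtain ⟨h1, -⟩ := mem_product.1 (mem_filter.1 hp).1
      have hm : X.transpose * Y = X.transpose * Y' :=
        (mem_filter.1 hp).2.trans (mem_filter.1 hp').2.symm
      refine Prod.ext rfl ?_
      change Y = Y'
      ext k c
      refine congrFun (hinj X h1 (a₁ := Y.col c) (a₂ := Y'.col c) ?_) k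
      funext a
      exact congrFun (congrFun hm a) c
    · intro s hs
      have hs : LinearIndependent F s := (mem_filter.1 hs).2
      let X : Matrix (Fin r) α F := Matrix.of fun k => (s k : α → F)
      have hXs : LinearIndependent F X.row := hs.map' W.subtype W.ker_subtype
      have hXm : X ∈ SX := mem_filter.2 ⟨mem_univ _, hXs⟩
      have hXW : LinearMap.range X.transpose.mulVecLin = W := by
        refine Submodule.eq_of_le_of_finrank_eq ?_ ?_
        · rw [Matrix.range_mulVecLin, Submodule.span_le]
          rintro _ ⟨k, rfl⟩
          exact (s k).2
        · rw [hW]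
          exact (Matrix.rank_transpose X).trans (by simpa using hXs.rank_matrix)
      -- The coordinates of the columns of `M` in the chosen basis are the columns of `Y`.
      have hcol : ∀ c, ∃ y, X.transpose.mulVec y = M.col c := by
        intro c
        have : M.col c ∈ W := ⟨Pi.single c 1, by simp⟩
        rw [← hXW] at this
        exact this
      choose y hy using hcol
      have hM' : X.transpose * (Matrix.of y).transpose = M := by
        ext a c
        exact congrFun (hy c) a
      refine ⟨(X, (Matrix.of y).transpose), mem_filter.2 ⟨mem_product.2 ⟨hXm, ?_⟩, hM'⟩, rfl⟩
      rw [hYrk, ← hrk X hXm, hM', hM]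
  have := Finset.card_eq_sum_card_fiberwise (s := SX ×ˢ SY)
    (t := univ.filter fun M : Matrix α κ F => M.rank = r) (f := fun p => p.1.transpose * p.2) (by
      intro p hp
      obtain ⟨h1, h2⟩ := mem_product.1 hp
      simp only [coe_filter, mem_univ, true_and, Set.mem_ofPred_eq]
      rw [hrk _ h1, (hYrk _).1 h2])
  rw [← hX, ← hY, ← Nat.cast_mul, ← card_product, this, Nat.cast_sum, Finset.sum_congr rfl hfib,
    sum_const, nsmul_eq_mul]

/-- The law of the rank of a uniform matrix. -/
theorem expect_rank (α κ : Type*) [Fintype α] [DecidableEq α] [Fintype κ] [DecidableEq κ]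
    (f : ℕ → ℝ) :
    (𝔼 M : Matrix α κ F, f M.rank) =
      ∑ r ∈ range (min (Fintype.card α) (Fintype.card κ) + 1),
        probRank (Fintype.card F) r (Fintype.card α) (Fintype.card κ) * f r := by
  classical
  have hq1 : (1 : ℝ) < Fintype.card F := by exact_mod_cast Fintype.one_lt_card
  have hq0 : (Fintype.card F : ℝ) ≠ 0 := by simp
  rw [Fintype.expect_eq_sum_div_card, ← Finset.sum_fiberwise_of_maps_to (s := univ)
    (t := range (min (Fintype.card α) (Fintype.card κ) + 1))
    (g := fun M : Matrix α κ F => M.rank) (fun M _ => mem_range.2 (Nat.lt_succ_of_le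
      (le_min M.rank_le_card_height M.rank_le_card_width))), Finset.sum_div]
  refine Finset.sum_congr rfl fun r hr => ?_
  have hr : r ≤ Fintype.card κ :=
    (Nat.lt_succ_iff.1 (mem_range.1 hr)).trans (min_le_right _ _)
  rw [Finset.sum_congr rfl (g := fun _ => f r) fun x hx => by rw [(mem_filter.1 hx).2],
    Finset.sum_const, nsmul_eq_mul, mul_div_right_comm]
  congr 1
  have h := card_rank_mul (F := F) (α := α) (κ := κ) r
  have hne : ∏ j ∈ range r, ((Fintype.card F : ℝ) ^ r - (Fintype.card F : ℝ) ^ j) ≠ 0 :=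
    prod_ne_zero_iff.2 fun j hj =>
      sub_ne_zero.2 (pow_lt_pow_right₀ hq1 (mem_range.1 hj)).ne'
  rw [← eq_div_iff hne] at h
  -- The second power of q cancels the one from `prod_sub_eq_probFull`; the first remains as the
  -- prefactor of `probRank`.
  have hcard : (Fintype.card (Matrix α κ F) : ℝ) =
      (Fintype.card F : ℝ) ^ (Fintype.card α * (Fintype.card κ - r)) *
        (Fintype.card F : ℝ) ^ (Fintype.card α * r) := by
    rw [← pow_add, ← mul_add, Nat.sub_add_cancel hr,
      ← Fintype.card_congr (Matrix.of (m := α) (n := κ) (α := F))]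
    simp [← pow_mul, mul_comm]
  rw [h, hcard, prod_sub_eq_probFull Fintype.card_ne_zero, probRank, gaussBinom, prod_div_distrib,
    ← probFull]
  field_simp

/-- The probability that the product of two uniform matrices is injective on a subspace. -/
theorem expect_mul_injOn (μ : Type*) {ν κ : Type*} [Fintype μ] [DecidableEq μ] [Fintype ν]
    [DecidableEq ν] [Fintype κ] [DecidableEq κ] (V : Submodule F (κ → F)) :
    (𝔼 C : Matrix ν κ F, 𝔼 G : Matrix μ ν F, open Classical in
      if ∀ x ∈ V, G.mulVec (C.mulVec x) = 0 → x = 0 then (1 : ℝ) else 0) =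
      probFull (Fintype.card F) (Fintype.card μ) (Module.finrank F V) *
        probFull (Fintype.card F) (Fintype.card ν) (Module.finrank F V) := by
  classical
  rw [← expect_injOn (ν := ν) V, Finset.mul_expect]
  refine Finset.expect_congr rfl fun C _ => ?_
  by_cases hC : ∀ x ∈ V, C.mulVec x = 0 → x = 0
  · rw [if_pos hC, mul_one]
    have hinj : Function.Injective (C.mulVecLin.domRestrict V) := by
      rw [← LinearMap.ker_eq_bot, LinearMap.ker_eq_bot']
      exact fun x hx => Subtype.ext (hC x x.2 hx)
    have hfin : Module.finrank F (V.map C.mulVecLin) = Module.finrank F V := by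
      rw [← LinearMap.range_domRestrict]
      exact LinearMap.finrank_range_of_inj hinj
    -- Given `C` injective on `V`, the condition on `G` is injectivity on the image of `V`; its
    -- probability depends on `C` only through the dimension, which is that of `V`.
    rw [← hfin, ← expect_injOn (ν := μ)]
    refine Finset.expect_congr rfl fun G _ => if_congr ?_ rfl rfl
    constructor
    · rintro h _ ⟨x, hx, rfl⟩ hG
      rw [h x hx hG, map_zero]
    · exact fun h x hx hG => hC x hx (h _ ⟨x, hx, rfl⟩ hG)
  · rw [if_neg hC, mul_zero]
    refine Finset.expect_eq_zero fun G _ => if_neg fun h => hC fun x hx hx0 => h x hx ?_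
    rw [hx0, Matrix.mulVec_zero]

/-- Relayed innovative packets complete the packets received directly with probability
`probTwo`. -/
theorem expect_decodable (α μ ν : Type*) (κ : Type*) [Fintype α] [DecidableEq α] [Fintype μ]
    [DecidableEq μ] [Fintype ν] [DecidableEq ν] [Fintype κ] [DecidableEq κ] :
    (𝔼 A : Matrix α κ F, 𝔼 C : Matrix ν κ F, 𝔼 G : Matrix μ ν F, open Classical in
      if ∀ x, A.mulVec x = 0 → G.mulVec (C.mulVec x) = 0 → x = 0 then (1 : ℝ) else 0) =
      probTwo (Fintype.card F) (Fintype.card μ + Fintype.card α)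
        (Fintype.card ν + Fintype.card α) (Fintype.card α) (Fintype.card κ) := by
  classical
  have key : ∀ A : Matrix α κ F, (𝔼 C : Matrix ν κ F, 𝔼 G : Matrix μ ν F,
      if ∀ x, A.mulVec x = 0 → G.mulVec (C.mulVec x) = 0 → x = 0 then (1 : ℝ) else 0) =
      probFull (Fintype.card F) (Fintype.card μ) (Fintype.card κ - A.rank) *
        probFull (Fintype.card F) (Fintype.card ν) (Fintype.card κ - A.rank) := by
    intro A
    have hfin : Module.finrank F (LinearMap.ker A.mulVecLin) = Fintype.card κ - A.rank := by
      have := A.mulVecLin.finrank_range_add_finrank_ker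
      rw [Module.finrank_fintype_fun_eq_card] at this
      exact (Nat.sub_eq_of_eq_add' this.symm).symm
    rw [← hfin, ← expect_mul_injOn]
    refine Finset.expect_congr rfl fun C _ => Finset.expect_congr rfl fun G _ =>
      if_congr ?_ rfl rfl
    simp only [LinearMap.mem_ker, Matrix.mulVecLin_apply]
  rw [Finset.expect_congr rfl fun A _ => key A, expect_rank (F := F) α κ fun r =>
    probFull (Fintype.card F) (Fintype.card μ) (Fintype.card κ - r) *
      probFull (Fintype.card F) (Fintype.card ν) (Fintype.card κ - r), probTwo]
  simp only [Nat.add_sub_cancel]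
  symm
  -- For ranks outside the interval in `probTwo`, μ or ν has fewer than |κ| - i elements, so a
  -- full-rank factor is zero.
  refine Finset.sum_subset (fun i hi => ?_) fun i hi hi' => ?_
  · simp only [mem_Icc, mem_range] at hi ⊢
    omega
  · simp only [mem_Icc, mem_range] at hi hi'
    rcases lt_or_ge (Fintype.card μ) (Fintype.card κ - i) with h | h
    · rw [probFull_eq_zero h, zero_mul, mul_zero]
    · rw [probFull_eq_zero (n := Fintype.card ν), mul_zero, mul_zero]
      omega

end Counting

/-! ### Discarding the packets already known to the destination. -/

section Reduction

variable {F : Type*} [Field F]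

theorem rank_eq_card_iff {α κ : Type*} [Fintype κ] (M : Matrix α κ F) :
    M.rank = Fintype.card κ ↔ ∀ x, M.mulVec x = 0 → x = 0 := by
  rw [← Matrix.ker_mulVecLin_eq_bot_iff, ← Submodule.finrank_eq_zero]
  have := M.mulVecLin.finrank_range_add_finrank_ker
  rw [Module.finrank_fintype_fun_eq_card] at this
  change Module.finrank F (LinearMap.range M.mulVecLin) = _ ↔ _
  omega

/-- The packets that are delivered under `b` but not under `a`. -/
abbrev Innovative {N : ℕ} (a b : Fin N → Bool) : Type := {i : Fin N // b i = true ∧ a i ≠ true}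

/-- For a single relay, decodability only involves the packets received directly and those
received by the relay alone. -/
theorem rank_destMatrix_iff {K NS NR : ℕ} (C : Matrix (Fin NS) (Fin K) F) (a : Fin NS → Bool)
    (b : Fin 1 → Fin NS → Bool) (G : ∀ j, Matrix (Fin NR) (Delivered (b j)) F)
    (d : Fin 1 → Fin NR → Bool) :
    (destMatrix C a b G d).rank = K ↔ ∀ x, (deliveredRows a C).mulVec x = 0 →
      (Matrix.of fun (k : Delivered (d 0)) (i : Innovative a (b 0)) =>
        G 0 k ⟨i, i.2.1⟩).mulVec ((C.submatrix (fun i : Innovative a (b 0) => (i : Fin NS))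
          id).mulVec x) = 0 → x = 0 := by
  have h := rank_eq_card_iff (destMatrix C a b G d)
  rw [Fintype.card_fin] at h
  rw [h]
  refine forall_congr' fun x => ?_
  rw [← and_imp]
  refine imp_congr ?_ Iff.rfl
  rw [destMatrix, Matrix.fromRows_mulVec, ← Sum.elim_zero_zero, Sum.elim_eq_iff]
  refine and_congr_right fun hx => ?_
  have hsum : ∀ k : Delivered (d 0), ((Matrix.blockDiagonal' (fun j => deliveredRows (d j) (G j)) *
      Matrix.of (fun x : (Σ j, Delivered (b j)) => deliveredRows (b x.1) C x.2)).mulVec x) ⟨0, k⟩ =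
      ((Matrix.of fun (k : Delivered (d 0)) (i : Innovative a (b 0)) =>
        G 0 k ⟨i, i.2.1⟩).mulVec ((C.submatrix (fun i : Innovative a (b 0) => (i : Fin NS))
          id).mulVec x)) k := by
    intro k
    rw [← Matrix.mulVec_mulVec]
    simp only [Matrix.mulVec, dotProduct, Fintype.sum_sigma, univ_unique, Fin.default_eq_zero,
      sum_singleton, Matrix.blockDiagonal'_apply_eq]
    symm
    -- The relay packets left out were also received directly, so `hx` makes their contributions
    -- zero.
    refine Finset.sum_of_injOn (fun i => ⟨i, i.2.1⟩) ?_ (by simp) ?_ ?_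
    · intro i _ j _ hij
      simpa [Subtype.ext_iff] using hij
    · intro i _ hi
      have hai : a i = true := by
        by_contra hne
        exact hi ⟨⟨i, i.2, hne⟩, by simp, rfl⟩
      have : ∑ j, C i j * x j = 0 := congrFun hx ⟨i, hai⟩
      change _ * (∑ j, C i j * x j) = 0
      rw [this, mul_zero]
    · intro i _
      rfl
  constructor
  · intro h0
    funext k
    rw [← hsum k, h0]
    rfl
  · intro h0
    funext ⟨j, k⟩
    obtain rfl := Subsingleton.elim j 0
    rw [hsum k, h0]
    rfl

variable [Fintype F]

/-- The decoding probability for fixed delivery patterns. -/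
theorem expect_rank_destMatrix {K NS NR : ℕ} (a : Fin NS → Bool)
    (b : Fin 1 → Fin NS → Bool) (d : Fin 1 → Fin NR → Bool) :
    (𝔼 C : Matrix (Fin NS) (Fin K) F, 𝔼 G : ∀ j, Matrix (Fin NR) (Delivered (b j)) F,
      if (destMatrix C a b G d).rank = K then (1 : ℝ) else 0) =
      probTwo (Fintype.card F) (Fintype.card (Delivered (d 0)) + Fintype.card (Delivered a))
        (Fintype.card (Innovative a (b 0)) + Fintype.card (Delivered a))
        (Fintype.card (Delivered a)) K := by
  classical
  let φ : Matrix (Fin NS) (Fin K) F →+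
      Matrix (Delivered a) (Fin K) F × Matrix (Innovative a (b 0)) (Fin K) F :=
    { toFun := fun C => (deliveredRows a C,
        C.submatrix (fun i : Innovative a (b 0) => (i : Fin NS)) id)
      map_zero' := rfl
      map_add' := fun _ _ => rfl }
  -- Direct and innovative packets have disjoint indices, so both blocks can be prescribed at once;
  -- this gives their independence and uniformity.
  have hφ : Function.Surjective φ := by
    rintro ⟨A, C⟩
    refine ⟨Matrix.of fun i => if h : a i = true then A ⟨i, h⟩ else
      if h' : b 0 i = true then C ⟨i, h', h⟩ else 0, Prod.ext ?_ ?_⟩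
    · funext i
      exact dif_pos i.2
    · funext i
      exact (dif_neg i.2.2).trans (dif_pos i.2.1)
  let ψ : (∀ j, Matrix (Fin NR) (Delivered (b j)) F) →+
      Matrix (Delivered (d 0)) (Innovative a (b 0)) F :=
    { toFun := fun G => Matrix.of fun k i => G 0 k ⟨i, i.2.1⟩
      map_zero' := rfl
      map_add' := fun _ _ => rfl }
  have hψ : Function.Surjective ψ := by
    intro G
    refine ⟨fun j => Matrix.of fun k i => if h : d 0 k = true ∧ b 0 i = true ∧ a i ≠ true then
      G ⟨k, h.1⟩ ⟨i, h.2⟩ else 0, ?_⟩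
    ext k i
    have h : d 0 k = true ∧ b 0 i = true ∧ a i ≠ true := ⟨k.2, i.2⟩
    exact dif_pos h
  have h := expect_decodable (F := F) (Delivered a) (Delivered (d 0)) (Innovative a (b 0)) (Fin K)
  rw [Fintype.card_fin K] at h
  rw [← h]
  let f : Matrix (Delivered a) (Fin K) F × Matrix (Innovative a (b 0)) (Fin K) F → ℝ :=
    fun p => 𝔼 G : Matrix (Delivered (d 0)) (Innovative a (b 0)) F,
      if ∀ x, p.1.mulVec x = 0 → G.mulVec (p.2.mulVec x) = 0 → x = 0 then (1 : ℝ) else 0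
  have hprod := Finset.expect_product (univ : Finset (Matrix (Delivered a) (Fin K) F))
    (univ : Finset (Matrix (Innovative a (b 0)) (Fin K) F)) f
  rw [univ_product_univ, ← expect_comp_of_surjective φ hφ] at hprod
  refine Eq.trans (Finset.expect_congr rfl fun C _ => ?_) hprod
  simp only [f]
  rw [← expect_comp_of_surjective ψ hψ]
  exact Finset.expect_congr rfl fun G _ => if_congr (rank_destMatrix_iff C a b G d) rfl rfl

end Reduction

/-! ### From probability laws to sums over delivery counts. -/

section Law

theorem toReal_bind_apply {α β : Type*} [Fintype α] (p : PMF α) (f : α → PMF β) (y : β) :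
    (p.bind f y).toReal = ∑ x, (p x).toReal * (f x y).toReal := by
  rw [PMF.bind_apply, tsum_fintype, ENNReal.toReal_sum fun x _ =>
    ENNReal.mul_ne_top (p.apply_ne_top x) ((f x).apply_ne_top y)]
  simp only [ENNReal.toReal_mul]

theorem sum_uniform_mul {α : Type*} [Fintype α] [Nonempty α] (g : α → ℝ) :
    ∑ x, (PMF.uniformOfFintype α x).toReal * g x = 𝔼 x, g x := by
  simp [Fintype.expect_eq_sum_div_card, ← Finset.mul_sum, div_eq_inv_mul]

theorem indep_uniform {ι : Type*} [Fintype ι] [DecidableEq ι] {α : ι → Type*}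
    [∀ i, Fintype (α i)] [∀ i, Nonempty (α i)] :
    indep (fun i => PMF.uniformOfFintype (α i)) = PMF.uniformOfFintype (∀ i, α i) := by
  ext f
  simp only [indep, PMF.ofFintype_apply, PMF.uniformOfFintype_apply, Fintype.card_pi,
    Nat.cast_prod]
  exact (ENNReal.prod_inv_distrib fun i _ j _ _ => by simp).symm

theorem toReal_link {N : ℕ} (ε : I) (d : Fin N → Bool) :
    (link N ε d).toReal = (1 - (ε : ℝ)) ^ #{i | d i = true} * (ε : ℝ) ^ (N - #{i | d i = true}) := by
  have h1 : (0 : ℝ) ≤ 1 - ε := by linarith [ε.2.2]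
  simp only [link, indep, packet, PMF.ofFintype_apply, ENNReal.toReal_prod]
  rw [Finset.prod_congr rfl (g := fun i => if d i = true then 1 - (ε : ℝ) else ε) fun i _ => by
    split_ifs
    · exact ENNReal.toReal_ofReal h1
    · exact ENNReal.toReal_ofReal ε.2.1, prod_ite, prod_const, prod_const]
  congr 2
  have := card_filter_add_card_filter_not (s := (univ : Finset (Fin N))) (fun i => d i = true)
  rw [card_univ, Fintype.card_fin] at this
  omega

theorem sum_delivered {N : ℕ} (f : Finset (Fin N) → ℝ) :
    ∑ d : Fin N → Bool, f {i | d i = true} = ∑ s, f s :=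
  Fintype.sum_equiv ⟨fun d => ({i | d i = true} : Finset (Fin N)), fun s i => decide (i ∈ s),
    fun d => by ext; simp, fun s => by ext; simp⟩ _ _ fun _ => rfl

theorem sum_by_card {N : ℕ} (f : Finset (Fin N) → ℝ) :
    ∑ s, f s = ∑ m ∈ range (N + 1), ∑ s ∈ powersetCard m univ, f s := by
  rw [← Finset.powerset_univ, Finset.sum_powerset, card_univ, Fintype.card_fin]

theorem sum_link {N : ℕ} (ε : I) (f : ℕ → ℝ) :
    ∑ d, (link N ε d).toReal * f #{i | d i = true} =
      ∑ m ∈ range (N + 1), binomPMF m N ε * f m := by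
  simp only [toReal_link]
  rw [sum_delivered fun s => (1 - (ε : ℝ)) ^ #s * (ε : ℝ) ^ (N - #s) * f #s, sum_by_card]
  refine Finset.sum_congr rfl fun m _ => ?_
  rw [Finset.sum_congr rfl fun s hs => by rw [(mem_powersetCard.1 hs).2], sum_const,
    card_powersetCard, card_univ, Fintype.card_fin, binomPMF, nsmul_eq_mul]
  ring

/-- The number of sets of given size with given overlap with `B`. -/
theorem card_inter_eq {N : ℕ} (B : Finset (Fin N)) (i j : ℕ) :
    #{A ∈ powersetCard j univ | #(A ∩ B) = i} =
      if i ≤ j then (#B).choose i * (N - #B).choose (j - i) else 0 := by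
  -- Without the guard, truncated `j - i` would be 0 for i > j and the product could be nonzero.
  split_ifs with hij
  · have hc : #Bᶜ = N - #B := by rw [card_compl, Fintype.card_fin]
    rw [← hc, ← card_powersetCard, ← card_powersetCard, ← card_product]
    refine Finset.card_nbij' (fun A => (A ∩ B, A \ B)) (fun p => p.1 ∪ p.2) ?_ ?_ ?_ ?_
    · intro A hA
      simp only [coe_filter, mem_powersetCard, subset_univ, true_and, Set.mem_ofPred_eq] at hA
      have := card_inter_add_card_sdiff A B
      simp only [coe_product, Set.mem_prod, mem_coe, mem_powersetCard]
      refine ⟨⟨inter_subset_right, hA.2⟩, fun x hx => ?_, by omega⟩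
      simpa using (mem_sdiff.1 hx).2
    · rintro ⟨X, Y⟩ hXY
      simp only [coe_product, Set.mem_prod, mem_coe, mem_powersetCard] at hXY
      obtain ⟨⟨hX, hXi⟩, hY, hYi⟩ := hXY
      have hd : Disjoint Y B := by rw [← le_compl_iff_disjoint_right]; exact hY
      simp only [coe_filter, mem_powersetCard, subset_univ, true_and, Set.mem_ofPred_eq]
      rw [card_union_of_disjoint (hd.symm.mono_left hX), union_inter_distrib_right,
        inter_eq_left.2 hX, disjoint_iff_inter_eq_empty.1 hd, union_empty]
      omega
    · intro A _
      exact (union_comm _ _).trans (sdiff_union_inter A B)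
    · rintro ⟨X, Y⟩ hXY
      simp only [coe_product, Set.mem_prod, mem_coe, mem_powersetCard] at hXY
      obtain ⟨⟨hX, hXi⟩, hY, hYi⟩ := hXY
      have hd : Disjoint Y B := by rw [← le_compl_iff_disjoint_right]; exact hY
      refine Prod.ext ?_ ?_
      · change (X ∪ Y) ∩ B = X
        rw [union_inter_distrib_right, inter_eq_left.2 hX, disjoint_iff_inter_eq_empty.1 hd,
          union_empty]
      · change (X ∪ Y) \ B = Y
        rw [union_sdiff_distrib, sdiff_eq_empty_iff_subset.2 hX, hd.sdiff_eq_left, empty_union]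
  · rw [card_eq_zero, filter_eq_empty_iff]
    intro A hA h
    have := card_le_card (inter_subset_left (s₁ := A) (s₂ := B))
    rw [(mem_powersetCard.1 hA).2] at this
    omega

/-- Grouping the two delivery patterns of stage one by the numbers of delivered packets. -/
theorem sum_link_link {N : ℕ} (εA εB : I) (f : ℕ → ℕ → ℕ → ℝ) :
    ∑ a, ∑ b, (link N εA a).toReal * (link N εB b).toReal *
      f #{i | b i = true} #{i | a i = true}
        #(({i | a i = true} : Finset (Fin N)) ∩ ({i | b i = true} : Finset (Fin N))) =
      ∑ m ∈ range (N + 1), ∑ mA ∈ range (N + 1), ∑ mAB ∈ Icc (m + mA - N) (min m mA),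
        alpha m mA mAB N εB εA * f m mA mAB := by
  rw [Finset.sum_comm]
  simp only [toReal_link]
  -- Fix the set `B` delivered over the second link; the sets `A` then enter only through their size
  -- and their overlap with `B`.
  have h1 : ∀ B : Finset (Fin N), ∑ a : Fin N → Bool, (1 - (εA : ℝ)) ^ #{i | a i = true} *
      (εA : ℝ) ^ (N - #{i | a i = true}) * ((1 - (εB : ℝ)) ^ #B * (εB : ℝ) ^ (N - #B)) *
      f #B #{i | a i = true} #(({i | a i = true} : Finset (Fin N)) ∩ B) =
      ∑ mA ∈ range (N + 1), ∑ mAB ∈ Icc (#B + mA - N) (min #B mA),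
        (#B).choose mAB * (N - #B).choose (mA - mAB) * ((1 - (εA : ℝ)) ^ mA *
          (εA : ℝ) ^ (N - mA) * ((1 - (εB : ℝ)) ^ #B * (εB : ℝ) ^ (N - #B)) * f #B mA mAB) := by
    intro B
    rw [sum_delivered fun A => (1 - (εA : ℝ)) ^ #A * (εA : ℝ) ^ (N - #A) *
      ((1 - (εB : ℝ)) ^ #B * (εB : ℝ) ^ (N - #B)) * f #B #A #(A ∩ B), sum_by_card]
    refine Finset.sum_congr rfl fun mA _ => ?_
    rw [← Finset.sum_fiberwise_of_maps_to (g := fun A => #(A ∩ B))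
      (t := Icc (#B + mA - N) (min #B mA))]
    · refine Finset.sum_congr rfl fun mAB hm => ?_
      rw [Finset.sum_congr rfl fun A hA => by
        rw [(mem_filter.1 hA).2, (mem_powersetCard.1 (mem_filter.1 hA).1).2], sum_const,
        card_inter_eq, if_pos ((mem_Icc.1 hm).2.trans (min_le_right _ _)), nsmul_eq_mul,
        Nat.cast_mul]
    · intro A hA
      have hA := (mem_powersetCard.1 hA).2
      have h2 := card_union_add_card_inter A B
      have h3 : #(A ∪ B) ≤ N := (card_le_univ _).trans_eq (Fintype.card_fin N)
      have h4 := card_le_card (inter_subset_left (s₁ := A) (s₂ := B))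
      have h5 := card_le_card (inter_subset_right (s₁ := A) (s₂ := B))
      simp only [mem_Icc, le_min_iff]
      omega
  simp only [h1]
  rw [sum_delivered fun B => ∑ mA ∈ range (N + 1), ∑ mAB ∈ Icc (#B + mA - N) (min #B mA),
        (#B).choose mAB * (N - #B).choose (mA - mAB) * ((1 - (εA : ℝ)) ^ mA *
          (εA : ℝ) ^ (N - mA) * ((1 - (εB : ℝ)) ^ #B * (εB : ℝ) ^ (N - #B)) * f #B mA mAB),
    sum_by_card]
  refine Finset.sum_congr rfl fun m hm => ?_
  rw [Finset.sum_congr rfl fun B hB => by rw [(mem_powersetCard.1 hB).2], sum_const,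
    card_powersetCard, card_univ, Fintype.card_fin, nsmul_eq_mul, Finset.mul_sum]
  refine Finset.sum_congr rfl fun mA _ => ?_
  rw [Finset.mul_sum]
  refine Finset.sum_congr rfl fun mAB hmAB => ?_
  have hle : mAB ≤ m := (mem_Icc.1 hmAB).2.trans (min_le_left _ _)
  -- Choosing `B` and then the overlap inside it amounts to choosing the overlap and then the rest
  -- of `B`, the order used in `alpha`.
  have hch : (N.choose m : ℝ) * m.choose mAB = N.choose mAB * (N - mAB).choose (m - mAB) := by
    exact_mod_cast Nat.choose_mul hle
  rw [alpha, ← hch]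
  ring

end Law

/-! ### The single-relay network. -/

theorem toReal_indep_one {N : ℕ} (ε : Fin 1 → I) (d : Fin 1 → Fin N → Bool) :
    ((indep fun j => link N (ε j)) d).toReal = (link N (ε 0) (d 0)).toReal := by
  simp [indep]

theorem sum_fin_one {α : Type*} [Fintype α] (f : α → ℝ) : ∑ x : Fin 1 → α, f (x 0) = ∑ x, f x :=
  Fintype.sum_equiv (Equiv.funUnique (Fin 1) α) _ _ fun _ => rfl

/-- The lower summation limit exceeds m₁₂. This accounts for the cutoffs m + mD ≥ K and m' + mD ≥ K.
-/
theorem probTwo_eq_zero {q m₁ m₂ m₁₂ K : ℕ} (h : m₁ < K ∨ m₂ < K) :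
    probTwo q m₁ m₂ m₁₂ K = 0 := by
  rw [probTwo, Icc_eq_empty, sum_empty]
  omega

/-- Erasure laws do not depend on the coefficients, so the coefficient averages can be moved inside
the sums over delivery patterns. -/
theorem decodingProb_one_eq_sum (F : Type*) [Field F] [Fintype F] (K NS NR : ℕ)
    (εSD : I) (εSR εRD : Fin 1 → I) :
    decodingProb F 1 K NS NR εSD εSR εRD =
      ∑ a, ∑ b, (link NS εSD a).toReal * (link NS (εSR 0) b).toReal *
        ∑ d, (link NR (εRD 0) d).toReal *
          probTwo (Fintype.card F) (Fintype.card (Delivered d) + Fintype.card (Delivered a))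
            (Fintype.card (Innovative a b) + Fintype.card (Delivered a))
            (Fintype.card (Delivered a)) K := by
  have hpure : ∀ n : ℕ, (PMF.pure n K).toReal = if n = K then (1 : ℝ) else 0 := fun n => by
    by_cases h : n = K
    · simp [h]
    · simp [h, Ne.symm h]
  simp only [decodingProb, destRank, toReal_bind_apply, indep_uniform, sum_uniform_mul,
    toReal_indep_one, hpure]
  rw [Finset.expect_sum_comm]
  refine Finset.sum_congr rfl fun a _ => ?_
  rw [← Finset.mul_expect, Finset.expect_sum_comm]
  simp only [mul_assoc]
  rw [← Finset.mul_sum]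
  congr 1
  refine Eq.trans ?_ (sum_fin_one _)
  refine Finset.sum_congr rfl fun b _ => ?_
  rw [← Finset.mul_expect]
  congr 1
  refine Eq.trans ?_ (sum_fin_one _)
  simp only [Finset.expect_sum_comm]
  refine Finset.sum_congr rfl fun d _ => ?_
  simp only [← Finset.mul_expect]
  rw [expect_rank_destMatrix]

theorem decodingProb_one_eq_singleRelaySum (F : Type*) [Field F] [Fintype F] (K NS NR : ℕ)
    (εSD : I) (εSR εRD : Fin 1 → I) :
    decodingProb F 1 K NS NR εSD εSR εRD =
      singleRelaySum (Fintype.card F) K NS NR εSD (εSR 0) (εRD 0) := by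
  have hcard : ∀ {N : ℕ} (a : Fin N → Bool),
      Fintype.card (Delivered a) = #{i | a i = true} := fun a => Fintype.card_subtype _
  have hinn : ∀ a b : Fin NS → Bool, Fintype.card (Innovative a b) = #{i | b i = true} -
      #(({i | a i = true} : Finset (Fin NS)) ∩ ({i | b i = true} : Finset (Fin NS))) := by
    intro a b
    have hd : ({i | b i = true ∧ a i ≠ true} : Finset (Fin NS)) =
        ({i | b i = true} : Finset (Fin NS)) \ ({i | a i = true} : Finset (Fin NS)) := by
      ext; simp
    rw [Fintype.card_subtype, hd, card_sdiff]
  rw [decodingProb_one_eq_sum]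
  simp only [hcard, hinn]
  have h := sum_link_link (N := NS) εSD (εSR 0) fun m mD mRD => ∑ d,
    (link NR (εRD 0) d).toReal * probTwo (Fintype.card F) (#{i | d i = true} + mD)
      (m - mRD + mD) mD K
  refine h.trans ?_
  rw [singleRelaySum, sumStageOne]
  refine Finset.sum_congr rfl fun m _ => ?_
  rw [Finset.sum_filter]
  refine Finset.sum_congr rfl fun mD _ => ?_
  split_ifs with hK
  · refine Finset.sum_congr rfl fun mRD _ => ?_
    rw [sum_link (εRD 0) fun m' => probTwo (Fintype.card F) (m' + mD) (m - mRD + mD) mD K,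
      Finset.sum_filter]
    congr 1
    refine Finset.sum_congr rfl fun m' _ => ?_
    split_ifs with hm'
    · rfl
    · rw [probTwo_eq_zero (by omega), mul_zero]
  -- When m + mD < K, the second argument m - mRD + mD of `probTwo` is also below K.
  · refine Finset.sum_eq_zero fun mRD _ => ?_
    rw [Finset.sum_eq_zero fun d _ => ?_, mul_zero]
    rw [probTwo_eq_zero (by omega), mul_zero]

theorem relayBound_one (q K NS NR : ℕ) (εSD : ℝ) (εSR εRD : Fin 1 → ℝ) :
    relayBound q 1 K NS NR εSD εSR εRD = singleRelaySum q K NS NR εSD (εSR 0) (εRD 0) := by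
  simp only [relayBound, singleRelaySum, univ_unique, Fin.default_eq_zero, prod_singleton,
    sum_singleton]
  congr 1
  funext m mD mRD
  congr 1
  refine Finset.sum_nbij' (fun x => x 0) (fun n _ => n) ?_ ?_ ?_ ?_ ?_
  · intro x hx
    simp only [mem_filter, Fintype.mem_piFinset] at hx ⊢
    exact ⟨hx.1 0, hx.2⟩
  · intro n hn
    simp only [mem_filter, Fintype.mem_piFinset] at hn ⊢
    exact ⟨fun _ => hn.1, hn.2⟩
  · intro x _
    funext j
    rw [Subsingleton.elim j 0]
  · intro n _
    rfl
  · intro x _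
    rfl

end RelayRLNC

theorem mainTheorem4 (F : Type*) [Field F] [Fintype F] (K NS NR : ℕ)
    (εSD : unitInterval) (εSR εRD : Fin 1 → unitInterval) :
    RelayRLNC.decodingProb F 1 K NS NR εSD εSR εRD =
        RelayRLNC.relayBound (Fintype.card F) 1 K NS NR (εSD : ℝ)
          (fun j => (εSR j : ℝ)) (fun j => (εRD j : ℝ)) ∧
      RelayRLNC.decodingProb F 1 K NS NR εSD εSR εRD =
        RelayRLNC.singleRelaySum (Fintype.card F) K NS NR (εSD : ℝ) (εSR 0 : ℝ) (εRD 0 : ℝ) := by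
  rw [RelayRLNC.relayBound_one, RelayRLNC.decodingProb_one_eq_singleRelaySum]
  exact ⟨rfl, rfl⟩
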